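/- For $n\in\mathbb N$ and $k\neq 0$, let $M_k^n$ denote the model space of constant curvature $k$. If $k>0$, it is the unit sphere $\mathbb S^n\subset\mathbb R^{n+1}$ with the distance $d(x,y)=\frac{1}{\sqrt k}\arccos (x\mid y)$. If $k<0$, it is the hyperbolic space $\mathbb H^n=\{u\in\mathbb R^{n+1}:\langle u\mid u\rangle=-1,\ u_{n+1}>0\}$, where $\langle u\mid v\rangle=-u_{n+1}v_{n+1}+\sum_{i=1}^n u_iv_i$, with the distance $d(x,y)=\frac{1}{\sqrt{-k}}\operatorname{arcosh}(-\langle x\mid y\rangle)$. Put $D_k=\pi/\sqrt k$ if $k>0$ and $D_k=\infty$ if $k<0$. For $t\in[0,1]$ and $d(x,y)<D_k$, write $(1-t)x+ty$ for the unique point $z$ with $d(x,z)=t\,d(x,y)$ and $d(y,z)=(1-t)\,d(x,y)$. **Proposition.** Let $k\in\mathbb R$, $k\ne 0$, and $n\in\mathbb N$. Let $C\subseteq M_k^n$ with $\operatorname{diam}(C)<D_k$, and let $x,y,x',y',a,b\in C$ satisfy $$a=\tfrac12 x+\tfrac12 x',\qquad b=\tfrac12 y+\tfrac12 y'.$$ Let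 $\gamma$ be the angle at $b$ between the geodesic segments $[b,y]$ and $[b,a]$, and let $\gamma'$ be the angle at $a$ between the geodesic segments $[a,x]$ and $[a,b]$ (an angle one of whose sides is a single point is taken to be $\pi/2$). Suppose that $$d(a,b)\le d\big((1-\lambda)x+\lambda a,\ (1-\lambda)y+\lambda b\big)\quad\text{for each }\lambda\in[0,1].$$ If one of the following holds: 1. $d(x,a)=0$; 2. $d(x,a)=d(y,b)$; 3. $d(x,a)<d(y,b)$ and, moreover, ($\gamma\le\pi/2$ or $\gamma'\ge\pi/2$) in case $k<0$, respectively ($\gamma\ge\pi/2$ or $\gamma'\le\pi/2$) in case $k>0$; then $d(x',y')\le d(x,y)$. -/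

import Mathlib

noncomputable section

/-- The Lorentz form `-u_{n+1} v_{n+1} + ∑_{i ≤ n} u_i v_i` on `ℝ^(n+1)`. -/
def lorentzForm {n : ℕ} (u v : Fin (n + 1) → ℝ) : ℝ :=
  -(u (Fin.last n) * v (Fin.last n)) + ∑ i : Fin n, u i.castSucc * v i.castSucc

/-- The unit sphere `𝕊^n` in `ℝ^(n+1)`, for the Euclidean scalar product. -/
def sphereSet (n : ℕ) : Set (Fin (n + 1) → ℝ) :=
  {u | u ⬝ᵥ u = 1}

/-- The upper sheet of the hyperboloid in `ℝ^(n+1)`, i.e. hyperbolic space `ℍ^n`. -/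
def hyperboloidSet (n : ℕ) : Set (Fin (n + 1) → ℝ) :=
  {u | lorentzForm u u = -1 ∧ 0 < u (Fin.last n)}

/-- The set underlying the model space `M_k^n`, always inside `ℝ^(n+1)`: the sphere for `k > 0`,
the hyperboloid for `k < 0`, and the hyperplane `u_{n+1} = 0` (a copy of `𝔼^n`) for `k = 0`. -/
def modelSet (k : ℝ) (n : ℕ) : Set (Fin (n + 1) → ℝ) :=
  if 0 < k then sphereSet n
  else if k < 0 then hyperboloidSet n
  else {u | u (Fin.last n) = 0}

/-- The points of the model space `M_k^n`. -/
@[ext] structure ModelSpace (k : ℝ) (n : ℕ) where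
  /-- the coordinates of the point in `ℝ^(n+1)` -/
  coords : Fin (n + 1) → ℝ
  mem : coords ∈ modelSet k n

namespace ModelSpace

variable {k : ℝ} {n : ℕ}

/-- The distance of `M_k^n`: the spherical distance (`cos d = (x | y)`, `d ∈ [0, π]`) times `1/√k`
for `k > 0`, the hyperbolic distance (`cosh d = -⟨x | y⟩`, `d ≥ 0`) times `1/√(-k)` for `k < 0`,
and the Euclidean distance for `k = 0`. -/
instance : Dist (ModelSpace k n) where
  dist x y :=
    if 0 < k then Real.arccos (x.coords ⬝ᵥ y.coords) / √k
    else if k < 0 then Real.arcosh (-lorentzForm x.coords y.coords) / √(-k)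
    else √((x.coords - y.coords) ⬝ᵥ (x.coords - y.coords))

/-- The diameter `D_k` of `M_k^n`: `π / √k` for `k > 0` and `∞` for `k ≤ 0`. -/
def diamBound (k : ℝ) : ENNReal :=
  if 0 < k then ENNReal.ofReal (Real.pi / √k) else ⊤

/-- The diameter of a subset of `M_k^n`, with values in `[0, ∞]`. -/
def setDiam (C : Set (ModelSpace k n)) : ENNReal :=
  ⨆ x ∈ C, ⨆ y ∈ C, ENNReal.ofReal (dist x y)

/-- `z = (1 - t) x + t y`: the point `z` satisfies `d(x,z) = t d(x,y)` and
`d(y,z) = (1 - t) d(x,y)`. -/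
def IsGeodComb (t : ℝ) (x y z : ModelSpace k n) : Prop :=
  dist x z = t * dist x y ∧ dist y z = (1 - t) * dist x y

/-- The scalar product on tangent vectors: the Lorentz form for `k < 0`, otherwise the Euclidean
one. -/
def tangentForm (k : ℝ) (u v : Fin (n + 1) → ℝ) : ℝ :=
  if k < 0 then lorentzForm u v else u ⬝ᵥ v

/-- A vector tangent to `M_k^n` at `p` that is a nonnegative multiple of the initial velocity of
the geodesic segment from `p` to `q`: the orthogonal projection `q - (p | q) p` for `k > 0`,
`q + ⟨p | q⟩ p` for `k < 0`, and `q - p` for `k = 0`. -/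
def initialVec (p q : ModelSpace k n) : Fin (n + 1) → ℝ :=
  if 0 < k then q.coords - (p.coords ⬝ᵥ q.coords) • p.coords
  else if k < 0 then q.coords + lorentzForm p.coords q.coords • p.coords
  else q.coords - p.coords

/-- The angle in `[0, π]` at `p` between the geodesic segments `[p, q]` and `[p, r]`, i.e. the
angle between their initial vectors. (It is `π / 2` by convention if `q = p` or `r = p`.) -/
def angleAt (p q r : ModelSpace k n) : ℝ :=
  Real.arccos (tangentForm k (initialVec p q) (initialVec p r) /
    (√(tangentForm k (initialVec p q) (initialVec p q)) *
      √(tangentForm k (initialVec p r) (initialVec p r))))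

end ModelSpace

end

/-! Write `x = cos α • a + sin α • u` and `y = cos β • b + sin β • v`, with `u ⊥ a`, `v ⊥ b` and
`α`, `β` the rescaled distances `d(x,a)`, `d(y,b)`. Reflection in the midpoints flips the signs of
`u` and `v`, so with `A = (u | b)` and `B = (a | v)` the claim becomes `S A + T B ≤ 0`, where `S =
sin α cos β` and `T = cos α sin β`. In the hyperbolic case `sinh`, `cosh` and the Lorentz form take
over.

The hypothesis on `d(a,b)` enters only through its first variation at `λ = 1`, which gives `α A + β
B ≤ 0`. The two inequalities have proportional weights if `α = β`, and the case `α = 0` is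
immediate. Otherwise `α (S A + T B) = S (α A + β B) - B (β S - α T)`, so `0 ≤ B (β S - α T)`
suffices. For `α < β` the sign of `β S - α T` comes from the monotonicity of `tan t / t` or `tanh t
/ t` (`sin_mul_cos_ratio_le`, `le_sinh_mul_cosh_ratio`). The angle conditions control the sign of
`B`, directly through `γ` or through `A` and `γ'`. -/

/-! ### Inequalities for real functions and the first variation -/

open Real in
-- Monotonicity of `tan t / t` without denominators. Concavity of `sin` between `0` and `β + α`,
-- taken at the point `β - α`, yields it through the addition formulas.
theorem sin_mul_cos_ratio_le {α β : ℝ} (hα : 0 ≤ α) (hαβ : α ≤ β) (hβ : β < π / 2) :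
    β * (sin α * cos β) ≤ α * (cos α * sin β) := by
  rcases (hα.trans hαβ).eq_or_lt with h0 | h0
  · have : α = 0 := by linarith
    simp [this, ← h0]
  have hs : 0 < β + α := by linarith
  have m1 : (0 : ℝ) ∈ Set.Icc (0 : ℝ) π := ⟨le_rfl, pi_pos.le⟩
  have m2 : β + α ∈ Set.Icc (0 : ℝ) π := ⟨hs.le, by linarith⟩
  have h := strictConcaveOn_sin_Icc.concaveOn.2 m1 m2 (by positivity : 0 ≤ 2 * α / (β + α))
    (div_nonneg (by linarith) hs.le : 0 ≤ (β - α) / (β + α)) (by field_simp; ring)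
  simp only [smul_eq_mul, mul_zero, sin_zero, zero_add] at h
  rw [div_mul_cancel₀ _ hs.ne', div_mul_eq_mul_div, div_le_iff₀ hs, sin_add, sin_sub] at h
  nlinarith

theorem convexOn_sinh_Ici : ConvexOn ℝ (Set.Ici 0) Real.sinh := by
  refine MonotoneOn.convexOn_of_deriv (convex_Ici 0) Real.continuous_sinh.continuousOn
    Real.differentiable_sinh.differentiableOn ?_
  rw [Real.deriv_sinh, interior_Ici]
  intro x hx y hy hxy
  rw [Real.cosh_le_cosh, abs_of_pos hx, abs_of_pos hy]
  exact hxy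

open Real in
-- Here `tanh t / t` decreases, since `sinh` is convex where `sin` was concave; the opposite sign is
-- why the angle conditions differ for `k < 0` and `k > 0`.
theorem le_sinh_mul_cosh_ratio {α β : ℝ} (hα : 0 ≤ α) (hαβ : α ≤ β) :
    α * (cosh α * sinh β) ≤ β * (sinh α * cosh β) := by
  rcases (hα.trans hαβ).eq_or_lt with h0 | h0
  · have : α = 0 := by linarith
    simp [this, ← h0]
  have hs : 0 < β + α := by linarith
  have m1 : (0 : ℝ) ∈ Set.Ici (0 : ℝ) := Set.mem_Ici.2 le_rfl
  have m2 : β + α ∈ Set.Ici (0 : ℝ) := Set.mem_Ici.2 hs.le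
  have h := convexOn_sinh_Ici.2 m1 m2 (by positivity : 0 ≤ 2 * α / (β + α))
    (div_nonneg (by linarith) hs.le : 0 ≤ (β - α) / (β + α)) (by field_simp; ring)
  simp only [smul_eq_mul, mul_zero, sinh_zero, zero_add] at h
  rw [div_mul_cancel₀ _ hs.ne', div_mul_eq_mul_div, le_div_iff₀ hs, sinh_add, sinh_sub] at h
  nlinarith

theorem weighted_sum_nonpos {α β A B S T : ℝ} (hα : 0 ≤ α) (hβ : 0 ≤ β) (hS : 0 ≤ S) (hT : 0 ≤ T)
    (h : α * A + β * B ≤ 0) (hα0 : α = 0 → S = 0) (hβ0 : β = 0 → T = 0)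
    (hc : α = 0 ∨ 0 ≤ B * (β * S - α * T)) : S * A + T * B ≤ 0 := by
  rcases hα.eq_or_lt with h0 | h0
  · rw [hα0 h0.symm]
    rcases hβ.eq_or_lt with h1 | h1
    · simp [hβ0 h1.symm]
    · have : B ≤ 0 := by
        rw [← h0] at h
        nlinarith
      nlinarith
  · have hc' := hc.resolve_left h0.ne'
    -- The left side equals `S * (α * A + β * B) - B * (β * S - α * T)`.
    have : α * (S * A + T * B) ≤ 0 := by nlinarith
    exact nonpos_of_mul_nonpos_right this h0

theorem derivative_nonpos_of_forall_le {f : ℝ → ℝ} {D : ℝ} (hf : HasDerivAt f D 0)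
    (h : ∀ s ∈ Set.Icc (0 : ℝ) 1, f s ≤ f 0) : D ≤ 0 := by
  have h1 := (hasDerivWithinAt_iff_tendsto_slope' (s := Set.Ioi (0 : ℝ)) (by simp)).1
    (hf.hasDerivWithinAt (s := Set.Ioi 0))
  refine le_of_tendsto h1 ?_
  filter_upwards [Ioc_mem_nhdsGT (zero_lt_one (α := ℝ))] with s hs
  rw [slope_def_field]
  exact div_nonpos_of_nonpos_of_nonneg (by linarith [h s ⟨hs.1.le, hs.2⟩]) (by linarith [hs.1])

open Real in
-- The left side of `h` is the scalar product of the points at parameter `s = 1 - λ` on the segments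
-- from `a` to `x` and from `b` to `y`. The `E` term is of second order in `s`, so it does not
-- contribute to the derivative at `0`.
theorem first_variation_trig {α β c A B E : ℝ}
    (h : ∀ s ∈ Set.Icc (0 : ℝ) 1, cos (s * α) * cos (s * β) * c + cos (s * α) * sin (s * β) * B +
      sin (s * α) * cos (s * β) * A + sin (s * α) * sin (s * β) * E ≤ c) :
    α * A + β * B ≤ 0 := by
  have d (θ : ℝ) : HasDerivAt (fun s : ℝ => s * θ) θ 0 := by
    simpa using (hasDerivAt_id (0 : ℝ)).mul_const θ
  have hf := (((((d α).cos.mul (d β).cos).mul_const c).add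
    (((d α).cos.mul (d β).sin).mul_const B)).add
    (((d α).sin.mul (d β).cos).mul_const A)).add (((d α).sin.mul (d β).sin).mul_const E)
  have := derivative_nonpos_of_forall_le hf (by
    intro s hs
    simpa using h s hs)
  simp at this
  linarith

open Real in
theorem first_variation_hyperbolic {α β c A B E : ℝ}
    (h : ∀ s ∈ Set.Icc (0 : ℝ) 1, cosh (s * α) * cosh (s * β) * c +
      cosh (s * α) * sinh (s * β) * B +
      sinh (s * α) * cosh (s * β) * A + sinh (s * α) * sinh (s * β) * E ≤ c) :
    α * A + β * B ≤ 0 := by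
  have d (θ : ℝ) : HasDerivAt (fun s : ℝ => s * θ) θ 0 := by
    simpa using (hasDerivAt_id (0 : ℝ)).mul_const θ
  have hf := (((((d α).cosh.mul (d β).cosh).mul_const c).add
    (((d α).cosh.mul (d β).sinh).mul_const B)).add
    (((d α).sinh.mul (d β).cosh).mul_const A)).add (((d α).sinh.mul (d β).sinh).mul_const E)
  have := derivative_nonpos_of_forall_le hf (by
    intro s hs
    simpa using h s hs)
  simp at this
  linarith

/-- Recovers the sign of a scalar product from that of the cosine of an angle. For a degenerate side
the quotient is `0` by convention, and `hp`, `hq` say that `f` vanishes too. -/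
theorem nonpos_of_div_sqrt_mul_sqrt {f p q : ℝ} (hp : p ≤ 0 → f = 0) (hq : q ≤ 0 → f = 0)
    (h : f / (√p * √q) ≤ 0) : f ≤ 0 := by
  rcases le_or_gt p 0 with h1 | h1
  · exact (hp h1).le
  rcases le_or_gt q 0 with h2 | h2
  · exact (hq h2).le
  have : 0 < √p * √q := mul_pos (Real.sqrt_pos.2 h1) (Real.sqrt_pos.2 h2)
  rwa [div_le_iff₀ this, zero_mul] at h

theorem nonneg_of_div_sqrt_mul_sqrt {f p q : ℝ} (hp : p ≤ 0 → f = 0) (hq : q ≤ 0 → f = 0)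
    (h : 0 ≤ f / (√p * √q)) : 0 ≤ f := by
  have := nonpos_of_div_sqrt_mul_sqrt (f := -f) (p := p) (q := q) (by simpa using hp)
    (by simpa using hq) (by rw [neg_div]; linarith)
  linarith

/-! ### The Lorentz form and the hyperboloid -/

section Lorentz

variable {n : ℕ} (u v w : Fin (n + 1) → ℝ) (c : ℝ)

theorem lorentzForm_comm : lorentzForm u v = lorentzForm v u := by
  simp [lorentzForm, mul_comm]

theorem lorentzForm_add_left : lorentzForm (u + v) w = lorentzForm u w + lorentzForm v w := by
  simp only [lorentzForm, Pi.add_apply, add_mul, Finset.sum_add_distrib]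
  ring

theorem lorentzForm_smul_left : lorentzForm (c • u) v = c * lorentzForm u v := by
  simp only [lorentzForm, Pi.smul_apply, smul_eq_mul, mul_assoc, mul_add, Finset.mul_sum]
  ring

theorem lorentzForm_add_right : lorentzForm u (v + w) = lorentzForm u v + lorentzForm u w := by
  rw [lorentzForm_comm, lorentzForm_add_left, lorentzForm_comm v, lorentzForm_comm w]

theorem lorentzForm_smul_right : lorentzForm u (c • v) = c * lorentzForm u v := by
  rw [lorentzForm_comm, lorentzForm_smul_left, lorentzForm_comm v]

theorem lorentzForm_sub_left : lorentzForm (u - v) w = lorentzForm u w - lorentzForm v w := by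
  rw [sub_eq_add_neg, ← neg_one_smul ℝ v, lorentzForm_add_left, lorentzForm_smul_left]
  ring

theorem lorentzForm_sub_right : lorentzForm u (v - w) = lorentzForm u v - lorentzForm u w := by
  rw [lorentzForm_comm, lorentzForm_sub_left, lorentzForm_comm v, lorentzForm_comm w]

theorem lorentzForm_zero_left : lorentzForm 0 v = 0 := by
  simp [lorentzForm]

theorem lorentzForm_zero_right : lorentzForm v 0 = 0 := by
  simp [lorentzForm]

variable {u v w c}

/-- The orthogonal complement of a unit timelike vector is positive definite. -/
theorem eq_zero_of_lorentzForm_self_nonpos (ha : lorentzForm u u = -1)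
    (hwu : lorentzForm w u = 0) (hw : lorentzForm w w ≤ 0) : w = 0 := by
  have hcs := Finset.sum_mul_sq_le_sq_mul_sq Finset.univ (fun i : Fin n => w i.castSucc)
    (fun i => u i.castSucc)
  simp only [lorentzForm, ← pow_two] at ha hwu hw
  set W := ∑ i : Fin n, w i.castSucc ^ 2 with hW
  set U := ∑ i : Fin n, u i.castSucc ^ 2
  have hW0 : 0 ≤ W := Finset.sum_nonneg fun i _ => sq_nonneg _
  have hU0 : 0 ≤ U := Finset.sum_nonneg fun i _ => sq_nonneg _
  have e : ∑ i : Fin n, w i.castSucc * u i.castSucc = w (Fin.last n) * u (Fin.last n) := by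
    linarith
  rw [e, mul_pow] at hcs
  -- With `w₀`, `u₀` the last coordinates, Cauchy–Schwarz reads `w₀² u₀² ≤ W (u₀² - 1)`, while `W ≤
  -- w₀²`.
  have hW1 : W ≤ 0 := by nlinarith
  have h0 : w (Fin.last n) = 0 := by
    have : w (Fin.last n) ^ 2 ≤ 0 := by nlinarith
    exact pow_eq_zero_iff two_ne_zero |>.1 (le_antisymm this (sq_nonneg _))
  have hi := (Finset.sum_eq_zero_iff_of_nonneg fun i _ => sq_nonneg (w (Fin.castSucc i))).1
    (le_antisymm hW1 hW0)
  funext i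
  refine Fin.lastCases h0 (fun j => ?_) i
  exact pow_eq_zero_iff two_ne_zero |>.1 (hi j (Finset.mem_univ j))

theorem one_le_neg_lorentzForm (hu : u ∈ hyperboloidSet n) (hv : v ∈ hyperboloidSet n) :
    1 ≤ -lorentzForm u v := by
  have h1 : 0 < -lorentzForm u v := by
    have hcs := Finset.sum_mul_sq_le_sq_mul_sq Finset.univ (fun i : Fin n => u i.castSucc)
      (fun i => v i.castSucc)
    obtain ⟨hu1, hu0⟩ := hu
    obtain ⟨hv1, hv0⟩ := hv
    simp only [lorentzForm, ← pow_two] at hu1 hv1 ⊢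
    set U := ∑ i : Fin n, u i.castSucc ^ 2
    set V := ∑ i : Fin n, v i.castSucc ^ 2
    have : ∑ i : Fin n, u i.castSucc * v i.castSucc < u (Fin.last n) * v (Fin.last n) := by
      refine lt_of_pow_lt_pow_left₀ 2 (by positivity) (hcs.trans_lt ?_)
      have hU : U = u (Fin.last n) ^ 2 - 1 := by linarith
      have hV : V = v (Fin.last n) ^ 2 - 1 := by linarith
      have hU0 : 0 ≤ U := Finset.sum_nonneg fun i _ => sq_nonneg _
      have hV0 : 0 ≤ V := Finset.sum_nonneg fun i _ => sq_nonneg _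
      nlinarith
    linarith
  by_contra hlt
  push Not at hlt
  -- The component of `u` orthogonal to `v` has square `⟨u | v⟩² - 1`, negative under the assumption
  -- `hlt`.
  have hw := eq_zero_of_lorentzForm_self_nonpos (u := v) (w := u + lorentzForm u v • v) hv.1
    (by rw [lorentzForm_add_left, lorentzForm_smul_left, hv.1]; ring)
    (by
      simp only [lorentzForm_add_left, lorentzForm_smul_left, lorentzForm_add_right,
        lorentzForm_smul_right, hv.1, hu.1, lorentzForm_comm v u]
      nlinarith)
  have h2 := congrArg (fun z => lorentzForm z u) hw
  simp only [lorentzForm_add_left, lorentzForm_smul_left, hu.1, lorentzForm_comm v u,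
    lorentzForm_zero_left] at h2
  nlinarith

open Real in
theorem hyperboloid_polar {x a : Fin (n + 1) → ℝ} (hx : x ∈ hyperboloidSet n)
    (ha : a ∈ hyperboloidSet n) {θ : ℝ} (hθ : 0 ≤ θ) (h : -lorentzForm x a = cosh θ) :
    ∃ u, x = cosh θ • a + sinh θ • u ∧ lorentzForm a u = 0 ∧ (θ = 0 ∨ lorentzForm u u = 1) := by
  have hc := cosh_sq θ
  have h' : lorentzForm x a = -cosh θ := by linarith
  rcases hθ.eq_or_lt with h0 | h0
  · refine ⟨0, ?_, lorentzForm_zero_right _, Or.inl h0.symm⟩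
    obtain rfl : θ = 0 := h0.symm
    rw [cosh_zero] at *
    have := eq_zero_of_lorentzForm_self_nonpos (u := a) (w := x - a) ha.1
      (by rw [lorentzForm_sub_left, ha.1, h']; ring)
      (by
        simp only [lorentzForm_sub_left, lorentzForm_sub_right, ha.1, hx.1, h',
          lorentzForm_comm a x]
        norm_num)
    simp [sub_eq_zero.1 this]
  · have hs : sinh θ ≠ 0 := (sinh_pos_iff.2 h0).ne'
    refine ⟨(sinh θ)⁻¹ • (x - cosh θ • a), ?_, ?_, Or.inr ?_⟩
    · rw [smul_inv_smul₀ hs]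
      abel
    · simp only [lorentzForm_smul_right, lorentzForm_sub_right, ha.1, lorentzForm_comm a x, h']
      ring
    · simp only [lorentzForm_smul_right, lorentzForm_sub_right, lorentzForm_smul_left,
        lorentzForm_sub_left, ha.1, hx.1, lorentzForm_comm a x, h']
      field_simp
      linarith

open Real in
theorem hyperboloid_geodesic_mem {x a u : Fin (n + 1) → ℝ} (hx : x ∈ hyperboloidSet n)
    (ha : a ∈ hyperboloidSet n) {θ s : ℝ} (hθ : 0 ≤ θ) (hs : s ∈ Set.Icc (0 : ℝ) 1)
    (hxu : x = cosh θ • a + sinh θ • u) (hau : lorentzForm a u = 0)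
    (hu : θ = 0 ∨ lorentzForm u u = 1) :
    cosh (s * θ) • a + sinh (s * θ) • u ∈ hyperboloidSet n := by
  rcases hθ.eq_or_lt with h0 | h0
  · simpa [← h0] using ha
  have hu := hu.resolve_left h0.ne'
  constructor
  · simp only [lorentzForm_add_left, lorentzForm_smul_left, lorentzForm_add_right,
      lorentzForm_smul_right, ha.1, hau, hu, lorentzForm_comm u a]
    have := cosh_sq (s * θ)
    nlinarith
  · have hp : 0 < sinh θ := sinh_pos_iff.2 h0
    have hx0 := hx.2
    have ha0 := ha.2
    rw [hxu] at hx0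
    simp only [Pi.add_apply, Pi.smul_apply, smul_eq_mul] at hx0 ⊢
    have hsp : 0 ≤ sinh (s * θ) := sinh_nonneg_iff.2 (mul_nonneg hs.1 hθ)
    have hd : 0 ≤ sinh (θ - s * θ) := sinh_nonneg_iff.2 (by nlinarith [hs.2])
    rw [sinh_sub] at hd
    -- After multiplication by `sinh θ` the point is `sinh (θ - s * θ) • a + sinh (s * θ) • x`, a
    -- nonnegative combination of points of the upper sheet.
    refine pos_of_mul_pos_right (a := sinh θ) ?_ hp.le
    have h1 := mul_nonneg hd ha0.le
    have h2 := mul_nonneg hsp hx0.le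
    rcases hsp.eq_or_lt with h3 | h3
    · rw [← h3]
      have := cosh_pos (s * θ)
      simp only [zero_mul, add_zero]
      positivity
    · have h2 := mul_pos h3 hx0
      nlinarith

end Lorentz

/-! ### The sphere -/

section Sphere

variable {n : ℕ}

theorem dotProduct_abs_le_one {u v : Fin (n + 1) → ℝ} (hu : u ∈ sphereSet n)
    (hv : v ∈ sphereSet n) : -1 ≤ u ⬝ᵥ v ∧ u ⬝ᵥ v ≤ 1 := by
  have h1 : 0 ≤ (u - v) ⬝ᵥ (u - v) := Finset.sum_nonneg fun i _ => mul_self_nonneg _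
  have h2 : 0 ≤ (u + v) ⬝ᵥ (u + v) := Finset.sum_nonneg fun i _ => mul_self_nonneg _
  have hu : u ⬝ᵥ u = 1 := hu
  have hv : v ⬝ᵥ v = 1 := hv
  simp only [sub_dotProduct, dotProduct_sub, add_dotProduct, dotProduct_add, hu, hv,
    dotProduct_comm v u] at h1 h2
  constructor <;> linarith

open Real in
theorem sphere_polar {x a : Fin (n + 1) → ℝ} (hx : x ∈ sphereSet n)
    (ha : a ∈ sphereSet n) {θ : ℝ} (hθ : 0 ≤ θ) (hθ' : θ < π) (h : x ⬝ᵥ a = cos θ) :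
    ∃ u, x = cos θ • a + sin θ • u ∧ a ⬝ᵥ u = 0 ∧ (θ = 0 ∨ u ⬝ᵥ u = 1) := by
  have hx : x ⬝ᵥ x = 1 := hx
  have ha : a ⬝ᵥ a = 1 := ha
  have hc := sin_sq_add_cos_sq θ
  rcases hθ.eq_or_lt with h0 | h0
  · refine ⟨0, ?_, by simp, Or.inl h0.symm⟩
    obtain rfl : θ = 0 := h0.symm
    rw [cos_zero] at *
    have : x - a = 0 := by
      rw [← dotProduct_self_eq_zero]
      simp only [sub_dotProduct, dotProduct_sub, ha, hx, h, dotProduct_comm a x]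
      norm_num
    simp [sub_eq_zero.1 this]
  · have hs : sin θ ≠ 0 := (sin_pos_of_pos_of_lt_pi h0 hθ').ne'
    refine ⟨(sin θ)⁻¹ • (x - cos θ • a), ?_, ?_, Or.inr ?_⟩
    · rw [smul_inv_smul₀ hs]
      abel
    · simp only [dotProduct_smul, dotProduct_sub, ha, dotProduct_comm a x, h, smul_eq_mul]
      ring
    · simp only [dotProduct_smul, dotProduct_sub, smul_dotProduct, smul_eq_mul,
        sub_dotProduct, ha, hx, dotProduct_comm a x, h]
      field_simp
      linarith

open Real in
theorem sphere_geodesic_mem {a u : Fin (n + 1) → ℝ}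
    (ha : a ∈ sphereSet n) {θ s : ℝ} (hau : a ⬝ᵥ u = 0) (hu : θ = 0 ∨ u ⬝ᵥ u = 1) :
    cos (s * θ) • a + sin (s * θ) • u ∈ sphereSet n := by
  rcases hu with rfl | hu
  · simpa using ha
  have ha : a ⬝ᵥ a = 1 := ha
  change _ ⬝ᵥ _ = (1 : ℝ)
  simp only [dotProduct_smul, dotProduct_add, smul_dotProduct, smul_eq_mul,
    add_dotProduct, ha, hu, hau, dotProduct_comm u a]
  have := cos_sq_add_sin_sq (s * θ)
  nlinarith

end Sphere

namespace ModelSpace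

variable {k : ℝ} {n : ℕ}

open Real

/-! ### Positive curvature -/

section Positive

theorem coords_mem_sphereSet (hk : 0 < k) (x : ModelSpace k n) : x.coords ∈ sphereSet n := by
  simpa [modelSet, hk] using x.mem

theorem dist_eq_arccos (hk : 0 < k) (x y : ModelSpace k n) :
    dist x y = arccos (x.coords ⬝ᵥ y.coords) / √k :=
  if_pos hk

theorem cos_arccos_dotProduct (hk : 0 < k) (x y : ModelSpace k n) :
    cos (arccos (x.coords ⬝ᵥ y.coords)) = x.coords ⬝ᵥ y.coords :=
  have h := dotProduct_abs_le_one (coords_mem_sphereSet hk x) (coords_mem_sphereSet hk y)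
  cos_arccos h.1 h.2

theorem dist_le_dist_iff_of_pos (hk : 0 < k) (x y z w : ModelSpace k n) :
    dist x y ≤ dist z w ↔ z.coords ⬝ᵥ w.coords ≤ x.coords ⬝ᵥ y.coords := by
  rw [dist_eq_arccos hk, dist_eq_arccos hk, div_le_div_iff_of_pos_right (sqrt_pos.2 hk)]
  refine ⟨fun h => ?_, arccos_le_arccos⟩
  rw [← cos_arccos_dotProduct hk x y, ← cos_arccos_dotProduct hk z w]
  exact cos_le_cos_of_nonneg_of_le_pi (arccos_nonneg _) (arccos_le_pi _) h

theorem isGeodComb_iff_of_pos (hk : 0 < k) (t : ℝ) (x y z : ModelSpace k n) :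
    IsGeodComb t x y z ↔
      arccos (x.coords ⬝ᵥ z.coords) = t * arccos (x.coords ⬝ᵥ y.coords) ∧
      arccos (y.coords ⬝ᵥ z.coords) = (1 - t) * arccos (x.coords ⬝ᵥ y.coords) := by
  have h := (sqrt_pos.2 hk).ne'
  simp only [IsGeodComb, dist_eq_arccos hk, ← mul_div_assoc, div_left_inj' h]

theorem dist_lt_of_setDiam_lt {C : Set (ModelSpace k n)} (hk : 0 < k)
    (hC : setDiam C < diamBound k) {x y : ModelSpace k n} (hx : x ∈ C) (hy : y ∈ C) :
    arccos (x.coords ⬝ᵥ y.coords) < π := by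
  have h1 : ENNReal.ofReal (dist x y) ≤ setDiam C :=
    le_iSup₂_of_le x hx (le_iSup₂_of_le y hy le_rfl)
  have h2 := h1.trans_lt hC
  rw [diamBound, if_pos hk, ENNReal.ofReal_lt_ofReal_iff (by positivity), dist_eq_arccos hk,
    div_lt_div_iff_of_pos_right (sqrt_pos.2 hk)] at h2
  exact h2

/-- The midpoint equations fix all scalar products among `x`, `x'`, `a`, and with these the
difference of the two vectors has norm zero. -/
theorem midpoint_reflection_of_pos (hk : 0 < k) {x x' a : ModelSpace k n}
    (h : IsGeodComb (1 / 2) x x' a) :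
    x'.coords = (2 * (x.coords ⬝ᵥ a.coords)) • a.coords - x.coords ∧
      arccos (x.coords ⬝ᵥ x'.coords) = 2 * arccos (x.coords ⬝ᵥ a.coords) := by
  rw [isGeodComb_iff_of_pos hk] at h
  have h1 : arccos (x.coords ⬝ᵥ x'.coords) = 2 * arccos (x.coords ⬝ᵥ a.coords) := by linarith
  have h2 : arccos (x'.coords ⬝ᵥ a.coords) = arccos (x.coords ⬝ᵥ a.coords) := by linarith
  refine ⟨?_, h1⟩
  have e1 := congrArg cos h1
  have e2 := congrArg cos h2
  rw [cos_two_mul] at e1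
  simp only [cos_arccos_dotProduct hk] at e1 e2
  have hx : x.coords ⬝ᵥ x.coords = 1 := coords_mem_sphereSet hk x
  have hx' : x'.coords ⬝ᵥ x'.coords = 1 := coords_mem_sphereSet hk x'
  have ha : a.coords ⬝ᵥ a.coords = 1 := coords_mem_sphereSet hk a
  rw [← sub_eq_zero, ← dotProduct_self_eq_zero]
  simp only [dotProduct_sub, sub_dotProduct, dotProduct_smul, smul_dotProduct, smul_eq_mul, hx, hx',
    ha, dotProduct_comm x'.coords x.coords, dotProduct_comm a.coords x.coords,
    dotProduct_comm a.coords x'.coords, e1, e2]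
  ring

theorem exists_isGeodComb_of_pos (hk : 0 < k) {x a : ModelSpace k n} {u : Fin (n + 1) → ℝ} {θ : ℝ}
    (hθ : arccos (x.coords ⬝ᵥ a.coords) = θ)
    (hx : x.coords = cos θ • a.coords + sin θ • u) (hau : a.coords ⬝ᵥ u = 0)
    (hu : θ = 0 ∨ u ⬝ᵥ u = 1) {s : ℝ} (hs : s ∈ Set.Icc (0 : ℝ) 1) :
    ∃ p : ModelSpace k n, p.coords = cos (s * θ) • a.coords + sin (s * θ) • u ∧
      IsGeodComb (1 - s) x a p := by
  have hθ0 : 0 ≤ θ := hθ ▸ arccos_nonneg _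
  have hθ1 : θ ≤ π := hθ ▸ arccos_le_pi _
  have ham := coords_mem_sphereSet hk a
  have ha : a.coords ⬝ᵥ a.coords = 1 := ham
  refine ⟨⟨_, by simpa [modelSet, hk] using sphere_geodesic_mem (s := s) ham hau hu⟩, rfl, ?_⟩
  rw [isGeodComb_iff_of_pos hk]
  simp only [hθ]
  constructor
  · have e : x.coords ⬝ᵥ (cos (s * θ) • a.coords + sin (s * θ) • u) = cos ((1 - s) * θ) := by
      rw [hx, show (1 - s) * θ = θ - s * θ by ring, cos_sub]
      simp only [dotProduct_add, add_dotProduct, dotProduct_smul, smul_dotProduct, smul_eq_mul, ha,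
        hau, dotProduct_comm u a.coords]
      rcases hu with rfl | hu
      · simp
      · rw [hu]
        ring
    rw [e, arccos_cos (by nlinarith [hs.2]) (by nlinarith [hs.1])]
  · have e : a.coords ⬝ᵥ (cos (s * θ) • a.coords + sin (s * θ) • u) = cos (s * θ) := by
      simp [ha, hau]
    rw [e, arccos_cos (by nlinarith [hs.1]) (by nlinarith [hs.2])]
    ring

theorem angleAt_of_pos (hk : 0 < k) (p q r : ModelSpace k n) :
    (π / 2 ≤ angleAt p q r →
      q.coords ⬝ᵥ r.coords - (p.coords ⬝ᵥ q.coords) * (p.coords ⬝ᵥ r.coords) ≤ 0) ∧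
    (angleAt p q r ≤ π / 2 →
      0 ≤ q.coords ⬝ᵥ r.coords - (p.coords ⬝ᵥ q.coords) * (p.coords ⬝ᵥ r.coords)) := by
  have hp : p.coords ⬝ᵥ p.coords = 1 := coords_mem_sphereSet hk p
  have e : tangentForm k (initialVec p q) (initialVec p r) =
      q.coords ⬝ᵥ r.coords - (p.coords ⬝ᵥ q.coords) * (p.coords ⬝ᵥ r.coords) := by
    simp only [tangentForm, initialVec, hk, hk.not_gt, if_true, if_false, dotProduct_sub,
      sub_dotProduct, dotProduct_smul, smul_dotProduct, smul_eq_mul, hp,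
      dotProduct_comm q.coords p.coords]
    ring
  have hz (q : ModelSpace k n) (h : tangentForm k (initialVec p q) (initialVec p q) ≤ 0) :
      initialVec p q = 0 := by
    rw [tangentForm, if_neg hk.not_gt] at h
    exact dotProduct_self_eq_zero.1
      (le_antisymm h (Finset.sum_nonneg fun i _ => mul_self_nonneg _))
  have h1 (h : tangentForm k (initialVec p q) (initialVec p q) ≤ 0) :
      tangentForm k (initialVec p q) (initialVec p r) = 0 := by
    simp [hz q h, tangentForm, hk.not_gt]
  have h2 (h : tangentForm k (initialVec p r) (initialVec p r) ≤ 0) :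
      tangentForm k (initialVec p q) (initialVec p r) = 0 := by
    simp [hz r h, tangentForm, hk.not_gt]
  rw [← e, angleAt, ← not_lt, arccos_lt_pi_div_two, not_lt, arccos_le_pi_div_two]
  exact ⟨nonpos_of_div_sqrt_mul_sqrt h1 h2, nonneg_of_div_sqrt_mul_sqrt h1 h2⟩

theorem dist_reflection_le_of_pos (hk : 0 < k) {C : Set (ModelSpace k n)}
    (hC : setDiam C < diamBound k) {x y x' y' a b : ModelSpace k n}
    (hx : x ∈ C) (hy : y ∈ C) (hx' : x' ∈ C) (hy' : y' ∈ C)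
    (hmida : IsGeodComb (1 / 2) x x' a) (hmidb : IsGeodComb (1 / 2) y y' b)
    (hab : ∀ t ∈ Set.Icc (0 : ℝ) 1, ∀ p q : ModelSpace k n,
      IsGeodComb t x a p → IsGeodComb t y b q → dist a b ≤ dist p q)
    (h : dist x a = 0 ∨ dist x a = dist y b ∨
      (dist x a < dist y b ∧ (π / 2 ≤ angleAt b y a ∨ angleAt a x b ≤ π / 2))) :
    dist x' y' ≤ dist x y := by
  have hr := sqrt_pos.2 hk
  obtain ⟨ex, hα2⟩ := midpoint_reflection_of_pos hk hmida
  obtain ⟨ey, hβ2⟩ := midpoint_reflection_of_pos hk hmidb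
  -- The diameter bound applied to `x, x'` and to `y, y'` puts the half-distances `α`, `β` below `π
  -- / 2`, where cosines are positive.
  have hα1 := dist_lt_of_setDiam_lt hk hC hx hx'
  have hβ1 := dist_lt_of_setDiam_lt hk hC hy hy'
  rw [hα2] at hα1
  rw [hβ2] at hβ1
  simp only [dist_eq_arccos hk x a, dist_eq_arccos hk y b, div_eq_zero_iff, hr.ne', or_false,
    div_left_inj' hr.ne', div_lt_div_iff_of_pos_right hr] at h
  have hα0 := arccos_nonneg (x.coords ⬝ᵥ a.coords)
  have hβ0 := arccos_nonneg (y.coords ⬝ᵥ b.coords)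
  have hca := cos_arccos_dotProduct hk x a
  have hcb := cos_arccos_dotProduct hk y b
  obtain ⟨α, hα⟩ : ∃ α, arccos (x.coords ⬝ᵥ a.coords) = α := ⟨_, rfl⟩
  obtain ⟨β, hβ⟩ : ∃ β, arccos (y.coords ⬝ᵥ b.coords) = β := ⟨_, rfl⟩
  rw [hα] at hα0 hα1 hca h
  rw [hβ] at hβ0 hβ1 hcb h
  obtain ⟨u, hxu, hau, huu⟩ := sphere_polar (coords_mem_sphereSet hk x) (coords_mem_sphereSet hk a)
    hα0 (by linarith) hca.symm
  obtain ⟨v, hyv, hbv, hvv⟩ := sphere_polar (coords_mem_sphereSet hk y) (coords_mem_sphereSet hk b)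
    hβ0 (by linarith) hcb.symm
  have ha : a.coords ⬝ᵥ a.coords = 1 := coords_mem_sphereSet hk a
  have hb : b.coords ⬝ᵥ b.coords = 1 := coords_mem_sphereSet hk b
  have hvar : α * (u ⬝ᵥ b.coords) + β * (a.coords ⬝ᵥ v) ≤ 0 := by
    refine first_variation_trig (c := a.coords ⬝ᵥ b.coords) (E := u ⬝ᵥ v) fun s hs => ?_
    obtain ⟨p, hp, hp'⟩ := exists_isGeodComb_of_pos hk hα hxu hau huu hs
    obtain ⟨q, hq, hq'⟩ := exists_isGeodComb_of_pos hk hβ hyv hbv hvv hs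
    have := (dist_le_dist_iff_of_pos hk _ _ _ _).1
      (hab (1 - s) ⟨by linarith [hs.2], by linarith [hs.1]⟩ p q hp' hq')
    rw [hp, hq] at this
    simp only [dotProduct_add, add_dotProduct, dotProduct_smul, smul_dotProduct,
      smul_eq_mul] at this
    linarith
  have hsa := sin_nonneg_of_nonneg_of_le_pi hα0 (by linarith)
  have hsb := sin_nonneg_of_nonneg_of_le_pi hβ0 (by linarith)
  have hcap : 0 < cos α := cos_pos_of_mem_Ioo ⟨by linarith [pi_pos], by linarith⟩
  have hcbp : 0 < cos β := cos_pos_of_mem_Ioo ⟨by linarith [pi_pos], by linarith⟩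
  have key : sin α * cos β * (u ⬝ᵥ b.coords) + cos α * sin β * (a.coords ⬝ᵥ v) ≤ 0 := by
    refine weighted_sum_nonpos hα0 hβ0 (by positivity) (by positivity) hvar (fun h => by simp [h])
      (fun h => by simp [h]) ?_
    rcases h with h | h | ⟨h, hang⟩
    · exact Or.inl h
    · right
      rw [h]
      simp [mul_comm]
    rcases hα0.eq_or_lt with h0 | h0
    · exact Or.inl h0.symm
    right
    have hB : a.coords ⬝ᵥ v ≤ 0 := by
      rcases hang with hang | hang
      · have := (angleAt_of_pos hk b y a).1 hang
        rw [hyv] at this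
        simp only [dotProduct_add, add_dotProduct, dotProduct_smul, smul_dotProduct, smul_eq_mul,
          hb, hbv, dotProduct_comm b.coords a.coords, dotProduct_comm v a.coords] at this
        have hs : 0 < sin β := sin_pos_of_pos_of_lt_pi (by linarith) (by linarith)
        exact nonpos_of_mul_nonpos_right (by linarith : sin β * (a.coords ⬝ᵥ v) ≤ 0) hs
      · have := (angleAt_of_pos hk a x b).2 hang
        rw [hxu] at this
        simp only [dotProduct_add, add_dotProduct, dotProduct_smul, smul_dotProduct, smul_eq_mul,
          ha, hau] at this
        have hs : 0 < sin α := sin_pos_of_pos_of_lt_pi (by linarith) (by linarith)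
        have hA : 0 ≤ u ⬝ᵥ b.coords :=
          nonneg_of_mul_nonneg_right (by linarith : 0 ≤ sin α * (u ⬝ᵥ b.coords)) hs
        -- Since `0 ≤ A`, `hvar` forces `β * B ≤ 0`, and `0 < β`.
        nlinarith
    exact mul_nonneg_of_nonpos_of_nonpos hB
      (sub_nonpos.2 (sin_mul_cos_ratio_le hα0 h.le (by linarith)))
  -- The difference `(x | y) - (x' | y')` is twice the left side of `key`.
  rw [dist_le_dist_iff_of_pos hk, ex, ey, ← hca, ← hcb, hxu, hyv]
  simp only [dotProduct_add, add_dotProduct, dotProduct_smul, smul_dotProduct, smul_eq_mul,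
    dotProduct_sub, sub_dotProduct]
  linarith

end Positive

/-! ### Negative curvature -/

section Negative

theorem coords_mem_hyperboloidSet (hk : k < 0) (x : ModelSpace k n) :
    x.coords ∈ hyperboloidSet n := by
  simpa [modelSet, hk, hk.not_gt] using x.mem

theorem dist_eq_arcosh (hk : k < 0) (x y : ModelSpace k n) :
    dist x y = arcosh (-lorentzForm x.coords y.coords) / √(-k) :=
  (if_neg hk.not_gt).trans (if_pos hk)

theorem one_le_neg_lorentzForm_coords (hk : k < 0) (x y : ModelSpace k n) :
    1 ≤ -lorentzForm x.coords y.coords :=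
  one_le_neg_lorentzForm (coords_mem_hyperboloidSet hk x) (coords_mem_hyperboloidSet hk y)

theorem cosh_arcosh_lorentzForm (hk : k < 0) (x y : ModelSpace k n) :
    cosh (arcosh (-lorentzForm x.coords y.coords)) = -lorentzForm x.coords y.coords :=
  cosh_arcosh (one_le_neg_lorentzForm_coords hk x y)

theorem dist_le_dist_iff_of_neg (hk : k < 0) (x y z w : ModelSpace k n) :
    dist x y ≤ dist z w ↔ lorentzForm z.coords w.coords ≤ lorentzForm x.coords y.coords := by
  rw [dist_eq_arcosh hk, dist_eq_arcosh hk,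
    div_le_div_iff_of_pos_right (sqrt_pos.2 (neg_pos.2 hk)),
    arcosh_le_arcosh (zero_lt_one.trans_le (one_le_neg_lorentzForm_coords hk x y))
      (zero_lt_one.trans_le (one_le_neg_lorentzForm_coords hk z w)), neg_le_neg_iff]

theorem isGeodComb_iff_of_neg (hk : k < 0) (t : ℝ) (x y z : ModelSpace k n) :
    IsGeodComb t x y z ↔
      arcosh (-lorentzForm x.coords z.coords) = t * arcosh (-lorentzForm x.coords y.coords) ∧
      arcosh (-lorentzForm y.coords z.coords) =
        (1 - t) * arcosh (-lorentzForm x.coords y.coords) := by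
  have h := (sqrt_pos.2 (neg_pos.2 hk)).ne'
  simp only [IsGeodComb, dist_eq_arcosh hk, ← mul_div_assoc, div_left_inj' h]

theorem midpoint_reflection_of_neg (hk : k < 0) {x x' a : ModelSpace k n}
    (h : IsGeodComb (1 / 2) x x' a) :
    x'.coords = (2 * -lorentzForm x.coords a.coords) • a.coords - x.coords := by
  rw [isGeodComb_iff_of_neg hk] at h
  have h1 : arcosh (-lorentzForm x.coords x'.coords) =
      2 * arcosh (-lorentzForm x.coords a.coords) := by linarith
  have h2 : arcosh (-lorentzForm x'.coords a.coords) =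
      arcosh (-lorentzForm x.coords a.coords) := by linarith
  have e1 := congrArg cosh h1
  have e2 := congrArg cosh h2
  have hc := cosh_sq (arcosh (-lorentzForm x.coords a.coords))
  rw [cosh_two_mul] at e1
  simp only [cosh_arcosh_lorentzForm hk] at e1 e2 hc
  have hx := (coords_mem_hyperboloidSet hk x).1
  have hx' := (coords_mem_hyperboloidSet hk x').1
  have ha := (coords_mem_hyperboloidSet hk a).1
  rw [neg_inj] at e2
  have e3 : lorentzForm x.coords x'.coords = 1 - 2 * lorentzForm x.coords a.coords ^ 2 := by
    linarith
  rw [← sub_eq_zero]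
  refine eq_zero_of_lorentzForm_self_nonpos ha ?_ ?_ <;>
  simp only [lorentzForm_sub_right, lorentzForm_sub_left, lorentzForm_smul_right,
    lorentzForm_smul_left, hx, hx', ha, lorentzForm_comm x'.coords x.coords,
    lorentzForm_comm a.coords x.coords, lorentzForm_comm a.coords x'.coords,
    e2, e3] <;>
  nlinarith

theorem exists_isGeodComb_of_neg (hk : k < 0) {x a : ModelSpace k n} {u : Fin (n + 1) → ℝ} {θ : ℝ}
    (hθ : arcosh (-lorentzForm x.coords a.coords) = θ)
    (hx : x.coords = cosh θ • a.coords + sinh θ • u) (hau : lorentzForm a.coords u = 0)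
    (hu : θ = 0 ∨ lorentzForm u u = 1) {s : ℝ} (hs : s ∈ Set.Icc (0 : ℝ) 1) :
    ∃ p : ModelSpace k n, p.coords = cosh (s * θ) • a.coords + sinh (s * θ) • u ∧
      IsGeodComb (1 - s) x a p := by
  have hθ0 : 0 ≤ θ := hθ ▸ arcosh_nonneg (one_le_neg_lorentzForm_coords hk x a)
  have ham := coords_mem_hyperboloidSet hk a
  have hp := hyperboloid_geodesic_mem (coords_mem_hyperboloidSet hk x) ham hθ0 hs hx hau hu
  refine ⟨⟨_, by simpa [modelSet, hk, hk.not_gt] using hp⟩, rfl, ?_⟩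
  rw [isGeodComb_iff_of_neg hk]
  simp only [hθ]
  constructor
  · have e : -lorentzForm x.coords (cosh (s * θ) • a.coords + sinh (s * θ) • u) =
        cosh ((1 - s) * θ) := by
      rw [hx, show (1 - s) * θ = θ - s * θ by ring, cosh_sub]
      simp only [lorentzForm_add_left, lorentzForm_add_right, lorentzForm_smul_right,
        lorentzForm_smul_left, ham.1, hau, lorentzForm_comm u a.coords]
      rcases hu with rfl | hu
      · simp
      · rw [hu]
        ring
    rw [e, arcosh_cosh (by nlinarith [hs.2])]
  · have e : -lorentzForm a.coords (cosh (s * θ) • a.coords + sinh (s * θ) • u) =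
        cosh (s * θ) := by
      simp [lorentzForm_add_right, lorentzForm_smul_right, ham.1, hau]
    rw [e, arcosh_cosh (by nlinarith [hs.1])]
    ring

theorem angleAt_of_neg (hk : k < 0) (p q r : ModelSpace k n) :
    (π / 2 ≤ angleAt p q r → lorentzForm q.coords r.coords +
      lorentzForm p.coords q.coords * lorentzForm p.coords r.coords ≤ 0) ∧
    (angleAt p q r ≤ π / 2 → 0 ≤ lorentzForm q.coords r.coords +
      lorentzForm p.coords q.coords * lorentzForm p.coords r.coords) := by
  have hp := (coords_mem_hyperboloidSet hk p).1
  have e : tangentForm k (initialVec p q) (initialVec p r) = lorentzForm q.coords r.coords +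
      lorentzForm p.coords q.coords * lorentzForm p.coords r.coords := by
    simp only [tangentForm, initialVec, hk, hk.not_gt, if_true, if_false, lorentzForm_add_left,
      lorentzForm_add_right, lorentzForm_smul_right, lorentzForm_smul_left, hp,
      lorentzForm_comm q.coords p.coords]
    ring
  have hz (q : ModelSpace k n) (h : tangentForm k (initialVec p q) (initialVec p q) ≤ 0) :
      initialVec p q = 0 := by
    rw [tangentForm, if_pos hk] at h
    refine eq_zero_of_lorentzForm_self_nonpos hp ?_ h
    simp only [initialVec, hk, hk.not_gt, if_true, if_false, lorentzForm_add_left,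
      lorentzForm_smul_left, hp, lorentzForm_comm q.coords p.coords]
    ring
  have h1 (h : tangentForm k (initialVec p q) (initialVec p q) ≤ 0) :
      tangentForm k (initialVec p q) (initialVec p r) = 0 := by
    simp [hz q h, tangentForm, hk, lorentzForm_zero_left]
  have h2 (h : tangentForm k (initialVec p r) (initialVec p r) ≤ 0) :
      tangentForm k (initialVec p q) (initialVec p r) = 0 := by
    simp [hz r h, tangentForm, hk, lorentzForm_zero_right]
  rw [← e, angleAt, ← not_lt, arccos_lt_pi_div_two, not_lt, arccos_le_pi_div_two]
  exact ⟨nonpos_of_div_sqrt_mul_sqrt h1 h2, nonneg_of_div_sqrt_mul_sqrt h1 h2⟩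

theorem dist_reflection_le_of_neg (hk : k < 0) {x y x' y' a b : ModelSpace k n}
    (hmida : IsGeodComb (1 / 2) x x' a) (hmidb : IsGeodComb (1 / 2) y y' b)
    (hab : ∀ t ∈ Set.Icc (0 : ℝ) 1, ∀ p q : ModelSpace k n,
      IsGeodComb t x a p → IsGeodComb t y b q → dist a b ≤ dist p q)
    (h : dist x a = 0 ∨ dist x a = dist y b ∨
      (dist x a < dist y b ∧ (angleAt b y a ≤ π / 2 ∨ π / 2 ≤ angleAt a x b))) :
    dist x' y' ≤ dist x y := by
  have hr := sqrt_pos.2 (neg_pos.2 hk)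
  have ex := midpoint_reflection_of_neg hk hmida
  have ey := midpoint_reflection_of_neg hk hmidb
  simp only [dist_eq_arcosh hk x a, dist_eq_arcosh hk y b, div_eq_zero_iff, hr.ne', or_false,
    div_left_inj' hr.ne', div_lt_div_iff_of_pos_right hr] at h
  have hα0 := arcosh_nonneg (one_le_neg_lorentzForm_coords hk x a)
  have hβ0 := arcosh_nonneg (one_le_neg_lorentzForm_coords hk y b)
  have hca := cosh_arcosh_lorentzForm hk x a
  have hcb := cosh_arcosh_lorentzForm hk y b
  obtain ⟨α, hα⟩ : ∃ α, arcosh (-lorentzForm x.coords a.coords) = α := ⟨_, rfl⟩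
  obtain ⟨β, hβ⟩ : ∃ β, arcosh (-lorentzForm y.coords b.coords) = β := ⟨_, rfl⟩
  rw [hα] at hα0 hca h
  rw [hβ] at hβ0 hcb h
  have ham := coords_mem_hyperboloidSet hk a
  have hbm := coords_mem_hyperboloidSet hk b
  obtain ⟨u, hxu, hau, huu⟩ := hyperboloid_polar (coords_mem_hyperboloidSet hk x) ham hα0 hca.symm
  obtain ⟨v, hyv, hbv, hvv⟩ := hyperboloid_polar (coords_mem_hyperboloidSet hk y) hbm hβ0 hcb.symm
  have hvar : α * lorentzForm u b.coords + β * lorentzForm a.coords v ≤ 0 := by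
    refine first_variation_hyperbolic (c := lorentzForm a.coords b.coords)
      (E := lorentzForm u v) fun s hs => ?_
    obtain ⟨p, hp, hp'⟩ := exists_isGeodComb_of_neg hk hα hxu hau huu hs
    obtain ⟨q, hq, hq'⟩ := exists_isGeodComb_of_neg hk hβ hyv hbv hvv hs
    have := (dist_le_dist_iff_of_neg hk _ _ _ _).1
      (hab (1 - s) ⟨by linarith [hs.2], by linarith [hs.1]⟩ p q hp' hq')
    rw [hp, hq] at this
    simp only [lorentzForm_add_left, lorentzForm_add_right, lorentzForm_smul_right,
      lorentzForm_smul_left] at this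
    linarith
  have hsa := sinh_nonneg_iff.2 hα0
  have hsb := sinh_nonneg_iff.2 hβ0
  have hcap := cosh_pos α
  have hcbp := cosh_pos β
  have key : sinh α * cosh β * lorentzForm u b.coords +
      cosh α * sinh β * lorentzForm a.coords v ≤ 0 := by
    -- Unlike for `k > 0`, `A ≤ 0` does not determine the sign of `B` through `hvar`. If `B ≤ 0` as
    -- well, the claim is trivial, so afterwards `A ≤ 0` implies `0 ≤ B`.
    by_cases hneg : lorentzForm u b.coords ≤ 0 ∧ lorentzForm a.coords v ≤ 0
    · exact add_nonpos (mul_nonpos_of_nonneg_of_nonpos (by positivity) hneg.1)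
        (mul_nonpos_of_nonneg_of_nonpos (by positivity) hneg.2)
    refine weighted_sum_nonpos hα0 hβ0 (by positivity) (by positivity) hvar (fun h => by simp [h])
      (fun h => by simp [h]) ?_
    rcases h with h | h | ⟨h, hang⟩
    · exact Or.inl h
    · right
      rw [h]
      simp [mul_comm]
    rcases hα0.eq_or_lt with h0 | h0
    · exact Or.inl h0.symm
    right
    have hB : 0 ≤ lorentzForm a.coords v := by
      rcases hang with hang | hang
      · have := (angleAt_of_neg hk b y a).2 hang
        rw [hyv] at this
        simp only [lorentzForm_add_left, lorentzForm_add_right, lorentzForm_smul_right,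
          lorentzForm_smul_left, hbm.1, hbv, lorentzForm_comm b.coords a.coords,
          lorentzForm_comm v a.coords] at this
        exact nonneg_of_mul_nonneg_right
          (by linarith : 0 ≤ sinh β * lorentzForm a.coords v) (sinh_pos_iff.2 (by linarith))
      · have := (angleAt_of_neg hk a x b).1 hang
        rw [hxu] at this
        simp only [lorentzForm_add_left, lorentzForm_add_right, lorentzForm_smul_right,
          lorentzForm_smul_left, ham.1, hau] at this
        have hA : lorentzForm u b.coords ≤ 0 := nonpos_of_mul_nonpos_right
          (by linarith : sinh α * lorentzForm u b.coords ≤ 0) (sinh_pos_iff.2 h0)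
        exact le_of_not_ge fun hB => hneg ⟨hA, hB⟩
    exact mul_nonneg hB (sub_nonneg.2 (le_sinh_mul_cosh_ratio hα0 h.le))
  rw [dist_le_dist_iff_of_neg hk, ex, ey, ← hca, ← hcb, hxu, hyv]
  simp only [lorentzForm_add_left, lorentzForm_add_right, lorentzForm_smul_right,
    lorentzForm_smul_left, lorentzForm_sub_left, lorentzForm_sub_right]
  linarith

end Negative

end ModelSpace

theorem mainTheorem6 (k : ℝ) (hk : k ≠ 0) (n : ℕ)
    (C : Set (ModelSpace k n)) (hC : ModelSpace.setDiam C < ModelSpace.diamBound k)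
    (x y x' y' a b : ModelSpace k n)
    (hx : x ∈ C) (hy : y ∈ C) (hx' : x' ∈ C) (hy' : y' ∈ C) (ha : a ∈ C) (hb : b ∈ C)
    (hmida : ModelSpace.IsGeodComb (1 / 2) x x' a)
    (hmidb : ModelSpace.IsGeodComb (1 / 2) y y' b)
    (hab : ∀ t ∈ Set.Icc (0 : ℝ) 1, ∀ p q : ModelSpace k n,
      ModelSpace.IsGeodComb t x a p → ModelSpace.IsGeodComb t y b q → dist a b ≤ dist p q)
    (h : dist x a = 0 ∨
      dist x a = dist y b ∨
      (dist x a < dist y b ∧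
        ((k < 0 ∧ (ModelSpace.angleAt b y a ≤ Real.pi / 2 ∨
            Real.pi / 2 ≤ ModelSpace.angleAt a x b)) ∨
          (0 < k ∧ (Real.pi / 2 ≤ ModelSpace.angleAt b y a ∨
            ModelSpace.angleAt a x b ≤ Real.pi / 2))))) :
    dist x' y' ≤ dist x y := by
  rcases hk.lt_or_gt with hk | hk
  · exact ModelSpace.dist_reflection_le_of_neg hk hmida hmidb hab
      (h.imp_right (Or.imp_right (And.imp_right fun h =>
        (h.resolve_right fun h' => hk.not_gt h'.1).2)))
  · exact ModelSpace.dist_reflection_le_of_pos hk hC hx hy hx' hy' hmida hmidb hab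
      (h.imp_right (Or.imp_right (And.imp_right fun h =>
        (h.resolve_left fun h' => hk.not_gt h'.1).2)))
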